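/- Equip the Cantor set $\{0,1\}^\omega$ of infinite binary sequences with the product topology and with the metric $d(x,y)=2^{-n}$ for $x\ne y$, where $n$ is the first index at which $x$ and $y$ differ (and $d(x,x)=0$). An asynchronous binary transducer consists of a finite set $S$ of states, an initial state $s_0\in S$, a transition function $t\colon S\times\{0,1\}\to S$, and an output function $o\colon S\times\{0,1\}\to\{0,1\}^*$ with values in the finite (possibly empty) binary words. A homeomorphism $f$ of $\{0,1\}^\omega$ is rational if there is such a transducer for which, for every $\psi=\sigma_1\sigma_2\cdots\in\{0,1\}^\omega$, one has $f(\psi)=o(s_1,\sigma_1)\,o(s_2,\sigma_2)\cdots$ (infinite concatenation), where $s_1=s_0$ and $s_{n+1}=t(s_n,\sigma_n)$ for all $n\ge 1$. It is bilipschitz if there is a constant $K>0$ with $K^{-1}d(x,y)\le d(f(x),f(y))\le K\,d(x,y)$ for all $x,y\in\{0,1\}^\omega$. Theorem. The homeomorphisms of $\{0,1\}^\omega$ that are both rational and bilipschitz form a group under composition, and this group is simple but not finitely generated. -/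

import Mathlib

namespace RationalGroup

/-- The Cantor set `{0,1}^ω` of infinite binary sequences, with the product topology
(`false` is the digit `0`, `true` is the digit `1`). -/
abbrev Cantor : Type := ℕ → Bool

/-- An asynchronous binary transducer with state set `S`; finiteness of `S` is demanded where
transducers are used. -/
structure Transducer (S : Type) where
  /-- the initial state -/
  init : S
  /-- the transition function -/
  next : S → Bool → S
  /-- the output function, with values in the finite binary words -/
  out : S → Bool → List Bool

/-- The finite word `o(s, σ₁⋯σₙ)`: the concatenation of the outputs produced along the
sequence of states that starts at `s` and reads the given word. -/
def Transducer.output {S : Type} (T : Transducer S) : S → List Bool → List Bool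
  | _, [] => []
  | s, a :: w => T.out s a ++ T.output (T.next s a) w

/-- The word formed by the first `n` digits of an infinite binary sequence. -/
def initialWord (ψ : Cantor) (n : ℕ) : List Bool := (List.range n).map ψ

/-- `T.Outputs s ψ x`: reading the infinite sequence `ψ` from state `s`, the infinite
concatenation `o(s, ψ)` of the outputs is the infinite sequence `x`. That is, every finite stage
of the output is an initial word of `x`, and the lengths of these stages are unbounded. -/
def Transducer.Outputs {S : Type} (T : Transducer S) (s : S) (ψ x : Cantor) : Prop :=
  (∀ n : ℕ, T.output s (initialWord ψ n) =
      initialWord x (T.output s (initialWord ψ n)).length) ∧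
    ∀ m : ℕ, ∃ n : ℕ, m ≤ (T.output s (initialWord ψ n)).length

/-- A homeomorphism of the Cantor set is rational if it is computed by a finite asynchronous
binary transducer started in its initial state. -/
def IsRational (f : Cantor ≃ₜ Cantor) : Prop :=
  ∃ (S : Type) (_ : Finite S) (T : Transducer S), ∀ ψ : Cantor, T.Outputs T.init ψ (f ψ)

section

attribute [local instance] PiNat.dist

/-- A homeomorphism of the Cantor set is bilipschitz if it distorts the standard metric
`dist x y = 2⁻ⁿ`, where `n` is the first index at which `x ≠ y` differ, by at most a bounded
factor in both directions. -/
def IsBilipschitz (f : Cantor ≃ₜ Cantor) : Prop :=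
  ∃ K : ℝ, 0 < K ∧ ∀ x y : Cantor,
    K⁻¹ * dist x y ≤ dist (f x) (f y) ∧ dist (f x) (f y) ≤ K * dist x y

end

end RationalGroup

/-! A rational bilipschitz homeomorphism is the same as a map that is finite-state in both
directions: reading a prefix of length `n` fixes an output prefix whose length differs from `n` by
at most a constant, and what remains is one of finitely many local maps. The bilipschitz bounds keep
input and output lengths close; conversely, a transducer can store a local map as its state and run
with a fixed delay. Finite-state maps are closed under composition, so these homeomorphisms form a
group (`mem_finiteStateGroup_iff`).

Simplicity: let `N` be a nontrivial normal subgroup. Some element of `N` moves a cone off itself, so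
`N` contains every commutator supported in that cone (`commutator_coneHom_mem`). An infinite
repetition swindle makes every element supported in a suitable subcone such a commutator
(`exists_commutator_eq`). Any element that fixes a cone is conjugate to one supported in that
subcone, and every element is a product of two that each fix a cone (`exists_eq_mul_fixes_cone`).

No finite generation: a map with at most `M` local maps preserves the sequences that are eventually
periodic with period a power of `M!`. One `M` would serve a finite generating set, yet translation
by the indicator of the multiples of a prime `q > M` sends the zero sequence outside this class. -/

namespace RationalGroup

/-! ### Prefixes and tails -/

/-- The sequence without its first `n` digits. -/
def tail (n : ℕ) (x : Cantor) : Cantor := fun i => x (n + i)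

/-- The first `n` digits of `p`, followed by `x`. -/
def splice (n : ℕ) (p x : Cantor) : Cantor := fun i => if i < n then p i else x (i - n)

/-- The digit `a`, followed by `x`. -/
def cons (a : Bool) (x : Cantor) : Cantor
  | 0 => a
  | i + 1 => x i

/-- The sequences `x` and `y` have the same first `n` digits. -/
def Agree (n : ℕ) (x y : Cantor) : Prop := ∀ i < n, x i = y i

theorem Agree.refl (n : ℕ) (x : Cantor) : Agree n x x := fun _ _ => rfl

theorem Agree.symm {n : ℕ} {x y : Cantor} (h : Agree n x y) : Agree n y x :=
  fun i hi => (h i hi).symm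

theorem Agree.trans {n : ℕ} {x y z : Cantor} (h : Agree n x y) (h' : Agree n y z) :
    Agree n x z := fun i hi => (h i hi).trans (h' i hi)

theorem Agree.mono {m n : ℕ} {x y : Cantor} (h : Agree n x y) (hmn : m ≤ n) : Agree m x y :=
  fun i hi => h i (hi.trans_le hmn)

theorem agree_splice (n : ℕ) (p x : Cantor) : Agree n p (splice n p x) :=
  fun i hi => by simp [splice, hi]

theorem splice_zero (p x : Cantor) : splice 0 p x = x := by
  ext i; simp [splice]

theorem tail_zero (x : Cantor) : tail 0 x = x := by
  ext i; simp [tail]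

theorem tail_splice (n : ℕ) (p x : Cantor) : tail n (splice n p x) = x := by
  ext i; simp [splice, tail]

theorem tail_splice_of_le {m n : ℕ} (h : m ≤ n) (p x : Cantor) :
    tail m (splice n p x) = splice (n - m) (tail m p) x := by
  ext i
  simp only [splice, tail]
  split_ifs
  · rfl
  · omega
  · omega
  · congr 1; omega

theorem tail_splice_of_ge {m n : ℕ} (h : n ≤ m) (p x : Cantor) :
    tail m (splice n p x) = tail (m - n) x := by
  ext i
  simp only [splice, tail]
  rw [if_neg (by omega)]
  congr 1; omega

theorem tail_tail (m n : ℕ) (x : Cantor) : tail m (tail n x) = tail (n + m) x := by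
  ext i; simp [tail, add_assoc]

theorem Agree.splice_tail {n : ℕ} {p x : Cantor} (h : Agree n p x) : splice n p (tail n x) = x := by
  ext i
  simp only [splice, tail]
  split_ifs with hi
  · exact h i hi
  · congr 1; omega

theorem splice_tail (n : ℕ) (x : Cantor) : splice n x (tail n x) = x := (Agree.refl n x).splice_tail

theorem splice_congr {n : ℕ} {p q : Cantor} (h : Agree n p q) (x : Cantor) :
    splice n p x = splice n q x := by
  ext i
  simp only [splice]
  split_ifs with hi
  · exact h i hi
  · rfl

theorem splice_splice (m n : ℕ) (p q x : Cantor) :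
    splice m p (splice n q x) = splice (m + n) (splice m p q) x := by
  ext i
  simp only [splice]
  split_ifs <;> first | rfl | omega | (congr 1; omega)

theorem splice_injective (n : ℕ) (p : Cantor) : Function.Injective (splice n p) := fun x y h => by
  rw [← tail_splice n p x, h, tail_splice]

theorem cons_zero (a : Bool) (x : Cantor) : cons a x 0 = a := rfl

theorem cons_succ (a : Bool) (x : Cantor) (i : ℕ) : cons a x (i + 1) = x i := rfl

theorem tail_one_cons (a : Bool) (x : Cantor) : tail 1 (cons a x) = x := by
  ext i; simp [tail, Nat.add_comm 1, cons]

theorem cons_tail (x : Cantor) : cons (x 0) (tail 1 x) = x := by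
  ext i; cases i <;> simp [tail, Nat.add_comm 1, cons]

theorem cons_eta {a : Bool} {x : Cantor} (h : x 0 = a) : cons a (tail 1 x) = x := by
  rw [← h, cons_tail]

theorem cons_splice (a : Bool) (n : ℕ) (p x : Cantor) :
    cons a (splice n p x) = splice (n + 1) (cons a p) x := by
  ext i; cases i <;> simp [splice, cons]

theorem splice_succ (n : ℕ) (p x : Cantor) :
    splice (n + 1) p x = cons (p 0) (splice n (tail 1 p) x) := by
  rw [cons_splice, cons_tail]

theorem splice_one (p x : Cantor) : splice 1 p x = cons (p 0) x := by
  rw [splice_succ, splice_zero]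

theorem splice_const_one (a : Bool) (x : Cantor) : splice 1 (fun _ => a) x = cons a x :=
  splice_one _ x

/-- There are finitely many ways to prepend a word of bounded length. -/
theorem finite_splice (c : ℕ) :
    {g : Cantor → Cantor | ∃ n ≤ c, ∃ p, g = splice n p}.Finite := by
  refine (Set.finite_range fun (z : Fin (c + 1) × (Fin c → Bool)) =>
    splice z.1 (fun i => if h : i < c then z.2 ⟨i, h⟩ else false)).subset ?_
  rintro _ ⟨n, hn, p, rfl⟩
  refine ⟨(⟨n, by omega⟩, fun i => p i), ?_⟩
  funext x
  refine splice_congr (fun i hi => ?_) x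
  simp only at hi
  simp [show i < c by omega]

/-! ### Finite-state and Lipschitz maps -/

/-- `f` has finitely many local maps, up to a bounded change of the length of prefixes. -/
def IsFiniteState (f : Cantor → Cantor) : Prop :=
  ∃ (c : ℕ) (C : Set (Cantor → Cantor)), C.Finite ∧ ∀ (n : ℕ) (p : Cantor),
    ∃ m, ∃ A ∈ C, n ≤ m + c ∧ m ≤ n + c ∧ ∀ x, f (splice n p x) = splice m (f p) (A x)

/-- Sequences that agree on `n + k` digits have images that agree on `n` digits. -/
def IsLipschitz (k : ℕ) (f : Cantor → Cantor) : Prop :=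
  ∀ n x y, Agree (n + k) x y → Agree n (f x) (f y)

theorem IsLipschitz.mono {k l : ℕ} {f : Cantor → Cantor} (h : IsLipschitz k f) (hkl : k ≤ l) :
    IsLipschitz l f := fun n x y hxy => h n x y (hxy.mono (by omega))

theorem IsLipschitz.sub {k : ℕ} {f : Cantor → Cantor} (h : IsLipschitz k f) {n : ℕ} {x y : Cantor}
    (hxy : Agree n x y) : Agree (n - k) (f x) (f y) := by
  rcases le_total k n with hk | hk
  · exact h _ _ _ (hxy.mono (by omega))
  · intro i hi; omega

theorem IsLipschitz.continuous {k : ℕ} {f : Cantor → Cantor} (h : IsLipschitz k f) :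
    Continuous f := by
  refine continuous_pi fun i => continuous_iff_continuousAt.2 fun x => ?_
  refine (continuousAt_const (y := f x i)).congr ?_
  have : ∀ᶠ y in nhds x, ∀ j ∈ Finset.range (i + 1 + k), x j = y j := by
    rw [Filter.eventually_all_finset]
    intro j _
    have hj : Filter.Tendsto (fun y : Cantor => y j) (nhds x) (pure (x j)) := by
      rw [← nhds_discrete]
      exact (continuous_apply j).continuousAt
    exact (Filter.tendsto_pure.1 hj).mono fun y hy => hy.symm
  filter_upwards [this] with y hy
  exact h (i + 1) x y (fun j hj => hy j (Finset.mem_range.2 hj)) i (by omega)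

theorem IsFiniteState.exists_isLipschitz {f : Cantor → Cantor} (hf : IsFiniteState f) :
    ∃ k, IsLipschitz k f := by
  obtain ⟨c, C, -, h⟩ := hf
  refine ⟨c, fun n x y hxy => ?_⟩
  obtain ⟨m, A, -, h1, -, h2⟩ := h (n + c) x
  rw [← hxy.splice_tail, h2]
  exact (agree_splice m _ _).mono (by omega)

theorem IsFiniteState.id : IsFiniteState fun x => x :=
  ⟨0, {fun x => x}, Set.finite_singleton _, fun n _ => ⟨n, _, rfl, by omega, by omega,
    fun _ => rfl⟩⟩

theorem IsFiniteState.comp {f g : Cantor → Cantor} (hf : IsFiniteState f) (hg : IsFiniteState g) :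
    IsFiniteState fun x => f (g x) := by
  obtain ⟨c, C, hC, h⟩ := hf
  obtain ⟨d, D, hD, k⟩ := hg
  refine ⟨c + d, Set.image2 (fun A B x => A (B x)) C D, hC.image2 _ hD, fun n p => ?_⟩
  obtain ⟨m, B, hB, h1, h2, h3⟩ := k n p
  obtain ⟨l, A, hA, h4, h5, h6⟩ := h m (g p)
  exact ⟨l, _, Set.mem_image2_of_mem hA hB, by omega, by omega, fun x => by
    simp only [h3, h6]⟩

theorem isFiniteState_splice (m : ℕ) (q : Cantor) : IsFiniteState (splice m q) :=
  ⟨m, {fun x => x}, Set.finite_singleton _, fun n p => ⟨m + n, _, rfl, by omega, by omega,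
    fun x => by rw [splice_splice]⟩⟩

theorem isFiniteState_cons (a : Bool) : IsFiniteState (cons a) := by
  convert isFiniteState_splice 1 (fun _ => a) using 1
  funext x
  rw [splice_const_one]

theorem isFiniteState_tail (j : ℕ) : IsFiniteState (tail j) := by
  refine ⟨j, (fun i => tail i) '' Set.Iic j, (Set.finite_Iic j).image _, fun n p => ?_⟩
  rcases le_total j n with h | h
  · refine ⟨n - j, _, ⟨0, by simp, rfl⟩, by omega, by omega, fun x => ?_⟩
    simp only [tail_splice_of_le h, tail_zero]
  · refine ⟨0, _, ⟨j - n, by simp, rfl⟩, by omega, by omega, fun x => ?_⟩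
    rw [tail_splice_of_ge h, splice_zero]

/-- Beyond depth `N` only the local maps of the finitely many pieces occur; up to depth `N`, `f`
composed with a short prefix serves as its own local map. -/
theorem IsFiniteState.piecewise {f : Cantor → Cantor} (N : ℕ)
    (h : ∀ p, ∃ g, IsFiniteState g ∧ ∀ x, Agree N p x → f x = g x) : IsFiniteState f := by
  let e : (Fin N → Bool) → Cantor := fun w i => if h : i < N then w ⟨i, h⟩ else false
  choose g hg hfg using h
  choose c C hC hc using hg
  obtain ⟨M, hM⟩ := (Set.finite_range fun w => c (e w)).bddAbove
  refine ⟨max M N, (⋃ w, C (e w)) ∪ (fun b x => f (b x)) '' _,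
    (Set.finite_iUnion fun w => hC _).union ((finite_splice N).image _), fun n p => ?_⟩
  rcases le_total N n with hn | hn
  · have hw : Agree N (e fun i => p i) p := fun i hi => by simp [e, hi]
    set w : Fin N → Bool := fun i => p i
    have hcw : c (e w) ≤ M := hM ⟨w, rfl⟩
    obtain ⟨m, A, hA, h1, h2, h3⟩ := hc (e w) n p
    refine ⟨m, A, Or.inl (Set.mem_iUnion.2 ⟨w, hA⟩), by omega, by omega, fun x => ?_⟩
    rw [hfg _ _ (hw.trans ((agree_splice n p x).mono hn)), hfg _ _ hw, h3]
  · exact ⟨0, _, Or.inr ⟨_, ⟨n, hn, p, rfl⟩, rfl⟩, by omega, by omega,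
      fun x => (splice_zero _ _).symm⟩

/-- A local map of the inverse prepends boundedly many digits and then inverts a local map of `f`,
which is injective because `f` is. -/
theorem IsFiniteState.symm (f : Cantor ≃ Cantor) (hf : IsFiniteState f) {l : ℕ}
    (hl : IsLipschitz l f.symm) : IsFiniteState f.symm := by
  obtain ⟨c, C, hC, h⟩ := hf
  refine ⟨l, Set.image2 (fun B b y => Function.invFun B (b y)) C _,
    hC.image2 _ (finite_splice (c + l)), fun n q => ?_⟩
  obtain ⟨m, B, hB, h1, h2, h3⟩ := h (n - l) (f.symm q)
  rw [f.apply_symm_apply] at h3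
  have hBinj : Function.Injective B := fun x y hxy =>
    splice_injective _ _ (f.injective (by rw [h3, h3, hxy]))
  have key : ∀ y, f.symm (splice n q y) =
      splice (n - l) (f.symm q) (tail (n - l) (f.symm (splice n q y))) := fun y =>
    ((hl.sub (agree_splice n q y)).splice_tail).symm
  have key' : ∀ y, splice n q y = splice m q (B (tail (n - l) (f.symm (splice n q y)))) := fun y => by
    rw [← h3, ← key, f.apply_symm_apply]
  -- The output prefix forced by `m` cannot outrun `q`: `f` is onto, so the digit at position `n`
  -- can be flipped.
  have hmn : m ≤ n := by
    by_contra! hlt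
    have := congrFun (key' fun _ => !(q n)) n
    simp [splice, hlt] at this
  refine ⟨n - l, _, Set.mem_image2_of_mem hB ⟨n - m, by omega, tail m q, rfl⟩, by omega, by omega,
    fun y => ?_⟩
  rw [key y]
  congr 1
  have := congrArg (tail m) (key' y)
  rw [tail_splice, tail_splice_of_le hmn] at this
  simp only [this, Function.leftInverse_invFun hBinj _]

/-- The local map of `f` at the first `n` digits of `p`, with the first `n - c` output digits
removed. -/
def localMap (f : Cantor → Cantor) (c n : ℕ) (p : Cantor) : Cantor → Cantor :=
  fun x => tail (n - c) (f (splice n p x))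

theorem IsFiniteState.exists_finite_localMap {f : Cantor → Cantor} (hf : IsFiniteState f) :
    ∃ c, IsLipschitz c f ∧ {g | ∃ n p, g = localMap f c n p}.Finite := by
  obtain ⟨k, hk⟩ := hf.exists_isLipschitz
  obtain ⟨c, C, hC, h⟩ := hf
  refine ⟨max c k, hk.mono (by omega),
    ((finite_splice (c + max c k)).image2 (fun b A x => b (A x)) hC).subset ?_⟩
  rintro _ ⟨n, p, rfl⟩
  obtain ⟨m, A, hA, h1, h2, h3⟩ := h n p
  refine ⟨_, ⟨m - (n - max c k), by omega, tail (n - max c k) (f p), rfl⟩, A, hA, ?_⟩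
  funext x
  simp only [localMap]
  rw [h3, tail_splice_of_le (by omega)]

/-! ### The metric, and Lipschitz maps in terms of prefixes -/

section

attribute [local instance] PiNat.dist

theorem agree_iff_dist_le {n : ℕ} {x y : Cantor} : Agree n x y ↔ dist x y ≤ (1 / 2 : ℝ) ^ n :=
  PiNat.mem_cylinder_iff_dist_le (E := fun _ => Bool)

theorem isLipschitz_of_dist_le {k : ℕ} {f : Cantor → Cantor}
    (h : ∀ x y, dist (f x) (f y) ≤ 2 ^ k * dist x y) : IsLipschitz k f := by
  intro n x y hxy
  rw [agree_iff_dist_le] at hxy ⊢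
  calc dist (f x) (f y) ≤ 2 ^ k * dist x y := h x y
    _ ≤ 2 ^ k * (1 / 2 : ℝ) ^ (n + k) := by gcongr
    _ = (1 / 2 : ℝ) ^ n := by
      rw [pow_add, mul_left_comm, ← mul_pow]; norm_num

theorem IsLipschitz.dist_le {k : ℕ} {f : Cantor → Cantor} (h : IsLipschitz k f) (x y : Cantor) :
    dist (f x) (f y) ≤ 2 ^ k * dist x y := by
  rcases eq_or_ne x y with rfl | hne
  · rw [PiNat.dist_self, PiNat.dist_self, mul_zero]
  · have hd := PiNat.dist_eq_of_ne (E := fun _ => Bool) hne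
    set m := PiNat.firstDiff x y
    have h1 := agree_iff_dist_le.1 (h.sub (agree_iff_dist_le.2 hd.le))
    rw [hd]
    refine h1.trans ?_
    calc (1 / 2 : ℝ) ^ (m - k) = 2 ^ k * (1 / 2 : ℝ) ^ (m - k + k) := by
          rw [pow_add, mul_left_comm, ← mul_pow]; norm_num
      _ ≤ 2 ^ k * (1 / 2 : ℝ) ^ m := by
          gcongr 2 ^ k * ?_
          exact pow_le_pow_of_le_one (by norm_num) (by norm_num) (by omega)

theorem isBilipschitz_iff (f : Cantor ≃ₜ Cantor) :
    IsBilipschitz f ↔ ∃ k, IsLipschitz k f ∧ IsLipschitz k f.symm := by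
  constructor
  · rintro ⟨K, hK, h⟩
    obtain ⟨k, hk⟩ := pow_unbounded_of_one_lt K (one_lt_two (α := ℝ))
    refine ⟨k, isLipschitz_of_dist_le fun x y => (h x y).2.trans ?_,
      isLipschitz_of_dist_le fun x y => ?_⟩
    · exact mul_le_mul_of_nonneg_right hk.le (PiNat.dist_nonneg _ _)
    · have := (h (f.symm x) (f.symm y)).1
      rw [f.apply_symm_apply, f.apply_symm_apply, inv_mul_le_iff₀ hK] at this
      exact this.trans (mul_le_mul_of_nonneg_right hk.le (PiNat.dist_nonneg _ _))
  · rintro ⟨k, h1, h2⟩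
    refine ⟨2 ^ k, by positivity, fun x y => ⟨?_, h1.dist_le x y⟩⟩
    rw [inv_mul_le_iff₀ (by positivity)]
    simpa using h2.dist_le (f x) (f y)

end

/-! ### Transducers versus finite-state maps -/

theorem initialWord_succ (x : Cantor) (n : ℕ) :
    initialWord x (n + 1) = initialWord x n ++ [x n] := by
  simp [initialWord, List.range_succ]

theorem initialWord_add (x : Cantor) (m n : ℕ) :
    initialWord x (m + n) = initialWord x m ++ initialWord (tail m x) n := by
  simp only [initialWord, List.range_add, List.map_append, List.map_map]
  rfl

@[simp] theorem length_initialWord (x : Cantor) (n : ℕ) : (initialWord x n).length = n := by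
  simp [initialWord]

theorem initialWord_eq_iff {n : ℕ} {x y : Cantor} :
    initialWord x n = initialWord y n ↔ Agree n x y := by
  simp [initialWord, Agree]

/-- The state reached from `s` by reading a word. -/
def Transducer.run {S : Type} (T : Transducer S) : S → List Bool → S
  | s, [] => s
  | s, a :: w => T.run (T.next s a) w

theorem Transducer.output_append {S : Type} (T : Transducer S) (s : S) (v w : List Bool) :
    T.output s (v ++ w) = T.output s v ++ T.output (T.run s v) w := by
  induction v generalizing s with
  | nil => rfl
  | cons a v ih => simp [Transducer.output, Transducer.run, ih]

theorem Transducer.run_append {S : Type} (T : Transducer S) (s : S) (v w : List Bool) :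
    T.run s (v ++ w) = T.run (T.run s v) w := by
  induction v generalizing s with
  | nil => rfl
  | cons a v ih => simp [Transducer.run, ih]

theorem Transducer.Outputs.unique {S : Type} {T : Transducer S} {s : S} {ψ x y : Cantor}
    (hx : T.Outputs s ψ x) (hy : T.Outputs s ψ y) : x = y := by
  funext i
  obtain ⟨n, hn⟩ := hx.2 (i + 1)
  have := (hx.1 n).symm.trans (hy.1 n)
  exact initialWord_eq_iff.1 this i (by omega)

theorem Transducer.Outputs.tail {S : Type} {T : Transducer S} {s : S} {ψ x : Cantor}
    (h : T.Outputs s ψ x) (n : ℕ) :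
    T.Outputs (T.run s (initialWord ψ n)) (tail n ψ)
      (tail (T.output s (initialWord ψ n)).length x) := by
  constructor
  · intro m
    have h1 := h.1 (n + m)
    rw [initialWord_add, Transducer.output_append, List.length_append, initialWord_add] at h1
    exact (List.append_inj h1 (by simp)).2
  · intro m
    obtain ⟨N, hN⟩ := h.2 ((T.output s (initialWord ψ n)).length + m)
    refine ⟨N, ?_⟩
    have h2 : initialWord ψ (n + N) = initialWord ψ N ++ initialWord (RationalGroup.tail N ψ) n := by
      rw [add_comm, initialWord_add]
    have h3 := congrArg (fun w => (T.output s w).length) h2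
    simp only [initialWord_add, Transducer.output_append, List.length_append] at h3
    omega

theorem isFiniteState_of_isRational {f : Cantor ≃ₜ Cantor} (hf : IsRational f) {k : ℕ}
    (h1 : IsLipschitz k f) (h2 : IsLipschitz k f.symm) : IsFiniteState f := by
  obtain ⟨S, _, T, hT⟩ := hf
  classical
  -- The default `x` is harmless: at states reachable from the initial one an output always exists.
  let F : S → Cantor → Cantor := fun s x => if h : ∃ y, T.Outputs s x y then h.choose else x
  have hF : ∀ {s x y}, T.Outputs s x y → F s x = y := fun {s x y} h => by
    have h' : ∃ y, T.Outputs s x y := ⟨y, h⟩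
    simp only [F, dif_pos h']
    exact h'.choose_spec.unique h
  let st : ℕ → Cantor → S := fun n p => T.run T.init (initialWord p n)
  let len : ℕ → Cantor → ℕ := fun n p => (T.output T.init (initialWord p n)).length
  have hw : ∀ n p x, initialWord (splice n p x) n = initialWord p n := fun n p x =>
    initialWord_eq_iff.2 (agree_splice n p x).symm
  have key : ∀ n p x, f (splice n p x) = splice (len n p) (f p) (F (st n p) x) := by
    intro n p x
    have h3 := (hT (splice n p x)).tail n
    rw [hw, tail_splice] at h3
    rw [hF h3, Agree.splice_tail]
    have h4 := (hT (splice n p x)).1 n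
    rw [hw, (hT p).1 n] at h4
    simpa using initialWord_eq_iff.1 (h4.trans (by simp))
  -- If `F s` separates two inputs at digit `i`, the Lipschitz bound for `f` limits the lag to `i +
  -- k`; if it identifies them, injectivity shows that `s` is never reached.
  have hc : ∀ s, ∃ c, ∀ n p, st n p = s → n ≤ len n p + c := by
    intro s
    by_cases hs : F s (fun _ => false) = F s (fun _ => true)
    · refine ⟨0, fun n p hp => ?_⟩
      have := f.injective ((key n p fun _ => false).trans
        ((congrArg _ (hp ▸ hs)).trans (key n p fun _ => true).symm))
      exact absurd (congrFun (splice_injective n p this) 0) (by simp)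
    · obtain ⟨i, hi⟩ := Function.ne_iff.1 hs
      refine ⟨i + k, fun n p hp => ?_⟩
      by_contra! hlt
      have h3 := h1.sub ((agree_splice n p fun _ => false).symm.trans
        (agree_splice n p fun _ => true)) (len n p + i) (by omega)
      rw [key, key, hp] at h3
      simp [splice] at h3
      exact hi h3
  choose c hc using hc
  obtain ⟨M, hM⟩ := (Set.finite_range c).bddAbove
  refine ⟨max M k, Set.range F, Set.finite_range F, fun n p => ⟨len n p, _, ⟨st n p, rfl⟩, ?_, ?_,
    key n p⟩⟩
  · have := hc _ n p rfl
    have : c (st n p) ≤ M := hM ⟨_, rfl⟩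
    omega
  -- Too long an output would force inputs differing at digit `n` to have images too close for the
  -- Lipschitz bound on the inverse.
  · by_contra! hlt
    have h3 : Agree (len n p) (f (splice n p fun _ => false)) (f (splice n p fun _ => true)) := by
      rw [key, key]
      exact (agree_splice _ _ _).symm.trans (agree_splice _ _ _)
    have h4 := h2.sub h3 n (by omega)
    simp [splice] at h4

theorem isRational_of_isFiniteState {f : Cantor ≃ₜ Cantor} (hf : IsFiniteState f) :
    IsRational f := by
  obtain ⟨c, hc, hfin⟩ := hf.exists_finite_localMap
  -- A state is the remaining delay together with the current local map. After `c` silent steps one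
  -- digit is emitted per digit read, already determined by the Lipschitz bound, so the filler
  -- `false` does not matter.
  let R : Set (ℕ × (Cantor → Cantor)) := Set.range fun z : ℕ × Cantor =>
    (c - z.1, localMap f c z.1 z.2)
  have hR : R.Finite := by
    refine ((Set.finite_Iic c).prod hfin).subset ?_
    rintro _ ⟨z, rfl⟩
    exact ⟨by simp, _, _, rfl⟩
  let step : ℕ × (Cantor → Cantor) → Bool → ℕ × (Cantor → Cantor) := fun s a =>
    (s.1 - 1, fun x => tail (1 - s.1) (s.2 (cons a x)))
  have hstep : ∀ n p a, step (c - n, localMap f c n p) a =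
      (c - (n + 1), localMap f c (n + 1) (splice n p (cons a p))) := by
    intro n p a
    refine Prod.ext (by simp [step]; omega) ?_
    funext x
    simp only [step, localMap, tail_tail]
    have : splice (n + 1) (splice n p (cons a p)) x = splice n p (cons a x) := by
      rw [← splice_splice, splice_one, cons_zero]
    rw [this]
    congr 1; omega
  let T : Transducer R :=
    { init := ⟨_, (0, fun _ => false), rfl⟩
      next := fun s a => ⟨step s.1 a, by
        obtain ⟨_, ⟨n, p⟩, rfl⟩ := s
        exact ⟨(n + 1, splice n p (cons a p)), (hstep n p a).symm⟩⟩
      out := fun s a => if s.1.1 = 0 then [s.1.2 (cons a fun _ => false) 0] else [] }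
  have hrun : ∀ ψ n, (T.run T.init (initialWord ψ n)).1 = (c - n, localMap f c n ψ) := by
    intro ψ n
    induction n with
    | zero =>
      refine Prod.ext rfl ?_
      funext x
      simp [initialWord, Transducer.run, T, localMap, splice_zero]
    | succ n ih =>
      rw [initialWord_succ, Transducer.run_append]
      change step (T.run T.init (initialWord ψ n)).1 (ψ n) = _
      rw [ih, hstep]
      refine Prod.ext rfl ?_
      funext x
      simp only [localMap]
      congr 2
      refine splice_congr (fun i hi => ?_) x
      rcases Nat.lt_succ_iff_lt_or_eq.1 hi with h | rfl
      · simp [splice, h]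
      · simp [splice, cons_zero]
  have hout : ∀ ψ n, T.output T.init (initialWord ψ n) = initialWord (f ψ) (n - c) := by
    intro ψ n
    induction n with
    | zero => simp [initialWord, Transducer.output]
    | succ n ih =>
      rw [initialWord_succ, Transducer.output_append, ih]
      change _ ++ ((if (T.run T.init (initialWord ψ n)).1.1 = 0 then
        [(T.run T.init (initialWord ψ n)).1.2 (cons (ψ n) fun _ => false) 0] else []) ++ []) = _
      rw [hrun, List.append_nil]
      split_ifs with h
      · simp only at h
        rw [show n + 1 - c = n - c + 1 by omega, initialWord_succ]
        congr 2
        have : Agree (n + 1) (splice n ψ (cons (ψ n) fun _ => false)) ψ := by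
          intro i hi
          rcases Nat.lt_succ_iff_lt_or_eq.1 hi with h | rfl
          · simp [splice, h]
          · simp [splice, cons_zero]
        exact hc.sub this (n - c) (by omega)
      · simp only at h
        rw [show n + 1 - c = 0 by omega, show n - c = 0 by omega, List.append_nil]
  refine ⟨R, hR, T, fun ψ => ⟨fun n => ?_, fun m => ⟨m + c, ?_⟩⟩⟩
  · rw [hout, length_initialWord]
  · rw [hout, length_initialWord]; omega

/-! ### The group and its cone subgroups -/

/-- The group of homeomorphisms of the Cantor set that are finite-state in both directions. -/
def finiteStateGroup : Subgroup (Cantor ≃ₜ Cantor) where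
  carrier := {f | IsFiniteState f ∧ IsFiniteState f.symm}
  mul_mem' hf hg := ⟨hf.1.comp hg.1, hg.2.comp hf.2⟩
  one_mem' := ⟨IsFiniteState.id, IsFiniteState.id⟩
  inv_mem' hf := ⟨hf.2, hf.1⟩

theorem mem_finiteStateGroup_iff (f : Cantor ≃ₜ Cantor) :
    f ∈ finiteStateGroup ↔ IsRational f ∧ IsBilipschitz f := by
  rw [isBilipschitz_iff]
  constructor
  · rintro ⟨h1, h2⟩
    obtain ⟨k, hk⟩ := h1.exists_isLipschitz
    obtain ⟨l, hl⟩ := h2.exists_isLipschitz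
    exact ⟨isRational_of_isFiniteState h1, max k l, hk.mono (by omega), hl.mono (by omega)⟩
  · rintro ⟨h, k, h1, h2⟩
    have hf := isFiniteState_of_isRational h h1 h2
    exact ⟨hf, IsFiniteState.symm f.toEquiv hf h2⟩

namespace finiteStateGroup

/-- The element given by two mutually inverse finite-state maps. -/
def mk (f g : Cantor → Cantor) (hf : IsFiniteState f) (hg : IsFiniteState g)
    (hgf : ∀ x, g (f x) = x) (hfg : ∀ x, f (g x) = x) : finiteStateGroup :=
  ⟨{ toFun := f
     invFun := g
     left_inv := hgf
     right_inv := hfg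
     continuous_toFun := hf.exists_isLipschitz.choose_spec.continuous
     continuous_invFun := hg.exists_isLipschitz.choose_spec.continuous }, hf, hg⟩

theorem mk_apply (f g : Cantor → Cantor) (hf : IsFiniteState f) (hg : IsFiniteState g)
    (hgf : ∀ x, g (f x) = x) (hfg : ∀ x, f (g x) = x) (x : Cantor) :
    (mk f g hf hg hgf hfg).1 x = f x := rfl

theorem ext {f g : finiteStateGroup} (h : ∀ x, f.1 x = g.1 x) : f = g :=
  Subtype.ext (Homeomorph.ext h)

@[simp] theorem mul_apply (f g : finiteStateGroup) (x : Cantor) : (f * g).1 x = f.1 (g.1 x) := rfl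

@[simp] theorem inv_apply_self (f : finiteStateGroup) (x : Cantor) : f⁻¹.1 (f.1 x) = x :=
  f.1.symm_apply_apply x

@[simp] theorem apply_inv_self (f : finiteStateGroup) (x : Cantor) : f.1 (f⁻¹.1 x) = x :=
  f.1.apply_symm_apply x

end finiteStateGroup

open finiteStateGroup

/-- The map that acts on the sequences that start with the first `n` digits of `p` as `f` does
on the remaining digits, and fixes all other sequences. -/
noncomputable def coneMap (n : ℕ) (p : Cantor) (f : Cantor → Cantor) : Cantor → Cantor :=
  open Classical in fun x => if Agree n p x then splice n p (f (tail n x)) else x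

theorem coneMap_splice (n : ℕ) (p : Cantor) (f : Cantor → Cantor) (x : Cantor) :
    coneMap n p f (splice n p x) = splice n p (f x) := by
  rw [coneMap, if_pos (agree_splice n p x), tail_splice]

theorem coneMap_of_not {n : ℕ} {p x : Cantor} (f : Cantor → Cantor) (h : ¬ Agree n p x) :
    coneMap n p f x = x := if_neg h

theorem coneMap_comp (n : ℕ) (p : Cantor) (f g : Cantor → Cantor) (x : Cantor) :
    coneMap n p f (coneMap n p g x) = coneMap n p (fun y => f (g y)) x := by
  by_cases h : Agree n p x
  · rw [← h.splice_tail]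
    simp only [coneMap_splice]
  · simp only [coneMap_of_not _ h]

theorem coneMap_eq_self {n : ℕ} {p : Cantor} {f : Cantor → Cantor} (hf : ∀ y, f y = y)
    (x : Cantor) : coneMap n p f x = x := by
  by_cases h : Agree n p x
  · rw [← h.splice_tail, coneMap_splice, hf]
  · exact coneMap_of_not _ h

theorem IsFiniteState.coneMap {f : Cantor → Cantor} (hf : IsFiniteState f) (n : ℕ) (p : Cantor) :
    IsFiniteState (coneMap n p f) := by
  refine .piecewise n fun q => ?_
  by_cases h : Agree n p q
  · exact ⟨_, (isFiniteState_splice n p).comp (hf.comp (isFiniteState_tail n)),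
      fun x hx => if_pos (h.trans hx)⟩
  · exact ⟨_, .id, fun x hx => if_neg fun h' => h (h'.trans hx.symm)⟩

/-- The embedding of the group as the group of a cone. -/
noncomputable def coneHom (n : ℕ) (p : Cantor) : finiteStateGroup →* finiteStateGroup :=
  MonoidHom.mk'
    (fun f => mk (coneMap n p f.1) (coneMap n p f⁻¹.1) (f.2.1.coneMap n p) (f.2.2.coneMap n p)
      (fun x => by rw [coneMap_comp, coneMap_eq_self (inv_apply_self f)])
      (fun x => by rw [coneMap_comp, coneMap_eq_self (apply_inv_self f)]))
    (fun f g => ext fun x => (coneMap_comp n p f.1 g.1 x).symm)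

theorem coneHom_splice (n : ℕ) (p : Cantor) (f : finiteStateGroup) (x : Cantor) :
    (coneHom n p f).1 (splice n p x) = splice n p (f.1 x) := coneMap_splice n p f.1 x

theorem coneHom_of_not {n : ℕ} {p x : Cantor} (f : finiteStateGroup) (h : ¬ Agree n p x) :
    (coneHom n p f).1 x = x := coneMap_of_not f.1 h

theorem agree_coneHom_iff {n : ℕ} {p x : Cantor} (f : finiteStateGroup) :
    Agree n p ((coneHom n p f).1 x) ↔ Agree n p x := by
  by_cases h : Agree n p x
  · rw [← h.splice_tail, coneHom_splice]
    exact iff_of_true (agree_splice _ _ _) (agree_splice _ _ _)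
  · rw [coneHom_of_not f h]

theorem coneHom_coneHom (m n : ℕ) (p q : Cantor) (f : finiteStateGroup) :
    coneHom m p (coneHom n q f) = coneHom (m + n) (splice m p q) f := by
  refine ext fun x => ?_
  by_cases h : Agree m p x
  · obtain ⟨y, rfl⟩ : ∃ y, splice m p y = x := ⟨_, h.splice_tail⟩
    rw [coneHom_splice]
    by_cases h' : Agree n q y
    · obtain ⟨z, rfl⟩ : ∃ z, splice n q z = y := ⟨_, h'.splice_tail⟩
      rw [coneHom_splice, splice_splice, splice_splice, coneHom_splice]
    · rw [coneHom_of_not f h', coneHom_of_not f]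
      refine fun h2 => h' fun i hi => ?_
      have := h2 (m + i) (by omega)
      simpa [splice] using this
  · rw [coneHom_of_not _ h, coneHom_of_not]
    refine fun h2 => h fun i hi => ?_
    have := h2 i (by omega)
    simpa [splice, hi] using this

/-- Conjugation by a map that acts on a cone as a replacement of the prefix. -/
theorem conj_coneHom {h : finiteStateGroup} {m n : ℕ} {p q : Cantor}
    (hh : ∀ x, h.1 (splice m p x) = splice n q x) (f : finiteStateGroup) :
    h * coneHom m p f * h⁻¹ = coneHom n q f := by
  refine ext fun x => ?_
  obtain ⟨y, rfl⟩ : ∃ y, h.1 y = x := ⟨h⁻¹.1 x, apply_inv_self h x⟩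
  simp only [mul_apply, inv_apply_self]
  by_cases h' : Agree m p y
  · rw [← h'.splice_tail, coneHom_splice, hh, hh, coneHom_splice]
  · rw [coneHom_of_not _ h', coneHom_of_not]
    refine fun h2 => h' ?_
    have := h.1.injective ((hh _).trans h2.splice_tail)
    exact this ▸ agree_splice m p _

/-- An element that fixes everything outside a cone comes from the embedding for that cone. -/
theorem exists_coneHom_eq {n : ℕ} {p : Cantor} {f : finiteStateGroup}
    (hf : ∀ x, ¬ Agree n p x → f.1 x = x) : ∃ g, coneHom n p g = f := by
  have key : ∀ f : finiteStateGroup, (∀ x, ¬ Agree n p x → f.1 x = x) →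
      ∀ x, splice n p (tail n (f.1 (splice n p x))) = f.1 (splice n p x) := by
    intro f hf x
    refine Agree.splice_tail ?_
    by_contra h
    have := f.1.injective (hf _ h)
    exact h (by rw [this]; exact agree_splice n p x)
  have hf' : ∀ x, ¬ Agree n p x → f⁻¹.1 x = x := fun x hx => by
    conv_lhs => rw [← hf x hx]
    exact inv_apply_self f x
  refine ⟨mk (fun x => tail n (f.1 (splice n p x))) (fun x => tail n (f⁻¹.1 (splice n p x)))
    ((isFiniteState_tail n).comp (f.2.1.comp (isFiniteState_splice n p)))
    ((isFiniteState_tail n).comp (f.2.2.comp (isFiniteState_splice n p)))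
    (fun x => by rw [key f hf, inv_apply_self, tail_splice])
    (fun x => by rw [key f⁻¹ hf', apply_inv_self, tail_splice]), ext fun x => ?_⟩
  by_cases h : Agree n p x
  · rw [← h.splice_tail, coneHom_splice, mk_apply, key f hf]
  · rw [coneHom_of_not _ h, hf x h]

/-! ### Translations and the contraction: moving cones -/

/-- The sequence of digitwise sums modulo 2. -/
def xorMap (t x : Cantor) : Cantor := fun i => xor (t i) (x i)

theorem xorMap_xorMap (t x : Cantor) : xorMap t (xorMap t x) = x := by
  ext i; simp [xorMap]

theorem isFiniteState_xorMap {t : Cantor} (ht : (Set.range fun n => tail n t).Finite) :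
    IsFiniteState (xorMap t) := by
  refine ⟨0, xorMap '' _, ht.image _, fun n p => ⟨n, _, ⟨_, ⟨n, rfl⟩, rfl⟩, by omega, by omega,
    fun x => ?_⟩⟩
  ext i
  simp only [xorMap, splice, tail]
  split_ifs with h
  · rfl
  · congr 2; omega

/-- Translation by a sequence with finitely many tails. -/
def xorElement (t : Cantor) (ht : (Set.range fun n => tail n t).Finite) : finiteStateGroup :=
  mk (xorMap t) (xorMap t) (isFiniteState_xorMap ht) (isFiniteState_xorMap ht)
    (xorMap_xorMap t) (xorMap_xorMap t)

theorem finite_tails_of_eq {t : Cantor} {a d : ℕ} (hd : 0 < d) (h : ∀ n ≥ a, t (n + d) = t n) :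
    (Set.range fun n => tail n t).Finite := by
  refine ((Set.finite_Iio (a + d)).image fun n => tail n t).subset ?_
  rintro _ ⟨n, rfl⟩
  induction n using Nat.strong_induction_on with
  | _ n ih =>
    by_cases hn : n < a + d
    · exact ⟨n, hn, rfl⟩
    · obtain ⟨m, hm, he⟩ := ih (n - d) (by omega)
      refine ⟨m, hm, he.trans ?_⟩
      funext i
      simp only [tail]
      rw [← h (n - d + i) (by omega)]
      congr 1; omega

theorem exists_xor_agree (n : ℕ) (p q : Cantor) :
    ∃ h : finiteStateGroup, ∀ x, Agree n p x ↔ Agree n q (h.1 x) := by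
  refine ⟨xorElement (splice n (xorMap p q) fun _ => false) (finite_tails_of_eq (a := n) (d := 1)
    one_pos fun i hi => ?_), fun x => ?_⟩
  · simp [splice, show ¬ i + 1 < n by omega, show ¬ i < n by omega]
  · refine forall₂_congr fun i hi => ?_
    change _ ↔ _ = xor (splice n (xorMap p q) (fun _ => false) i) (x i)
    simp only [splice, hi, if_true, xorMap]
    cases p i <;> cases q i <;> cases x i <;> decide

/-- The map `0x ↦ 00x`, `10x ↦ 01x`, `11x ↦ 1x`. -/
def contractMap (x : Cantor) : Cantor :=
  if x 0 = false then cons false x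
  else if x 1 = false then cons false (cons true (tail 2 x)) else tail 1 x

/-- The map `00x ↦ 0x`, `01x ↦ 10x`, `1x ↦ 11x`. -/
def expandMap (x : Cantor) : Cantor :=
  if x 0 = true then cons true x
  else if x 1 = true then cons true (cons false (tail 2 x)) else tail 1 x

theorem isFiniteState_contractMap : IsFiniteState contractMap := by
  refine .piecewise 2 fun p => ?_
  by_cases h0 : p 0 = false
  · exact ⟨_, isFiniteState_cons false, fun x hx => by simp [contractMap, ← hx 0, h0]⟩
  by_cases h1 : p 1 = false
  · exact ⟨_, (isFiniteState_cons false).comp ((isFiniteState_cons true).comp (isFiniteState_tail 2)),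
      fun x hx => by simp [contractMap, ← hx 0, ← hx 1, h0, h1]⟩
  · exact ⟨_, isFiniteState_tail 1, fun x hx => by simp [contractMap, ← hx 0, ← hx 1, h0, h1]⟩

theorem isFiniteState_expandMap : IsFiniteState expandMap := by
  refine .piecewise 2 fun p => ?_
  by_cases h0 : p 0 = true
  · exact ⟨_, isFiniteState_cons true, fun x hx => by simp [expandMap, ← hx 0, h0]⟩
  by_cases h1 : p 1 = true
  · exact ⟨_, (isFiniteState_cons true).comp ((isFiniteState_cons false).comp (isFiniteState_tail 2)),
      fun x hx => by simp [expandMap, ← hx 0, ← hx 1, h0, h1]⟩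
  · exact ⟨_, isFiniteState_tail 1, fun x hx => by simp [expandMap, ← hx 0, ← hx 1, h0, h1]⟩

theorem tail_two_cons_cons (a b : Bool) (x : Cantor) : tail 2 (cons a (cons b x)) = x := by
  rw [← tail_tail 1 1, tail_one_cons, tail_one_cons]

theorem exists_cons_cons (x : Cantor) : ∃ a b y, x = cons a (cons b y) :=
  ⟨x 0, tail 1 x 0, tail 1 (tail 1 x), by rw [cons_tail, cons_tail]⟩

theorem expandMap_contractMap (x : Cantor) : expandMap (contractMap x) = x := by
  obtain ⟨a, b, y, rfl⟩ := exists_cons_cons x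
  cases a <;> cases b <;>
    simp [contractMap, expandMap, cons, tail_two_cons_cons, tail_one_cons]

theorem contractMap_expandMap (x : Cantor) : contractMap (expandMap x) = x := by
  obtain ⟨a, b, y, rfl⟩ := exists_cons_cons x
  cases a <;> cases b <;>
    simp [contractMap, expandMap, cons, tail_two_cons_cons, tail_one_cons]

/-- The standard generator of Thompson's group, contracting towards `0` repeated. -/
def contraction : finiteStateGroup :=
  mk contractMap expandMap isFiniteState_contractMap isFiniteState_expandMap
    expandMap_contractMap contractMap_expandMap

/-- Each step drops a leading `1` from `11…` and turns `10…` into `01…`, so a `0` among the first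
`n` digits reaches the front within `n` steps and stays there. -/
theorem contraction_pow_apply_zero (n : ℕ) {x : Cantor} (hx : x 0 = false ∨ ∃ i < n, x i = false) :
    (contraction ^ n).1 x 0 = false := by
  induction n generalizing x with
  | zero => simpa using hx
  | succ n ih =>
    rw [pow_succ, mul_apply]
    refine ih ?_
    change contractMap x 0 = false ∨ ∃ i < n, contractMap x i = false
    unfold contractMap
    by_cases h0 : x 0 = false
    · exact .inl (by simp [h0, cons_zero])
    by_cases h1 : x 1 = false
    · exact .inl (by simp [h0, h1, cons_zero])
    · obtain ⟨i, hi, hx⟩ := hx.resolve_left h0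
      match i, hi, hx with
      | 0, _, hx => exact absurd hx h0
      | 1, _, hx => exact absurd hx h1
      | i + 2, hi, hx =>
        refine .inr ⟨i + 1, by omega, ?_⟩
        rw [if_neg h0, if_neg h1, tail, ← hx]
        congr 1; omega

theorem agree_contraction_pow (m : ℕ) {x : Cantor} (hx : x 0 = false) :
    Agree (m + 1) (fun _ => false) ((contraction ^ m).1 x) := by
  induction m with
  | zero => intro i hi; simp [show i = 0 by omega, hx]
  | succ m ih =>
    rw [pow_succ', mul_apply]
    change Agree _ _ (contractMap _)
    rw [contractMap, if_pos (ih 0 (by omega)).symm]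
    intro i hi
    cases i with
    | zero => rfl
    | succ i => exact ih i (by omega)

/-- The complement of any cone can be moved into any cone. -/
theorem exists_move_into (m n : ℕ) (p q : Cantor) :
    ∃ h : finiteStateGroup, ∀ x, ¬ Agree n p x → Agree m q (h.1 x) := by
  obtain ⟨a, ha⟩ := exists_xor_agree n p fun _ => true
  obtain ⟨b, hb⟩ := exists_xor_agree m (fun _ => false) q
  -- First `a` takes the cone to that of `1…1`, so its complement has a `0` early; the powers gather
  -- this complement near `000…`, and `b` moves it to `q`.
  refine ⟨b * (contraction ^ m * contraction ^ n) * a, fun x hx => ?_⟩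
  rw [mul_apply, mul_apply, mul_apply, ← hb]
  rw [ha, Agree] at hx
  push Not at hx
  obtain ⟨i, hi, hx⟩ := hx
  refine (agree_contraction_pow m (contraction_pow_apply_zero n (.inr ⟨i, hi, ?_⟩))).mono (by omega)
  simpa using hx.symm

/-! ### The swindle: supported elements are commutators -/

/-- The map that acts as `f` on the digits after the first `0`. -/
def repeatMap (f : Cantor → Cantor) : Cantor → Cantor
  | x, 0 => x 0
  | x, i + 1 => if x 0 = true then repeatMap f (tail 1 x) i else f (tail 1 x) i

theorem repeatMap_cons_true (f : Cantor → Cantor) (x : Cantor) :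
    repeatMap f (cons true x) = cons true (repeatMap f x) := by
  funext i
  cases i with
  | zero => rfl
  | succ i => rw [repeatMap, cons_zero, if_pos rfl, tail_one_cons, cons_succ]

theorem repeatMap_cons_false (f : Cantor → Cantor) (x : Cantor) :
    repeatMap f (cons false x) = cons false (f x) := by
  funext i
  cases i with
  | zero => rfl
  | succ i => rw [repeatMap, cons_zero, if_neg (by decide), tail_one_cons, cons_succ]

theorem repeatMap_comp {f g : Cantor → Cantor} (h : ∀ x, f (g x) = x) (x : Cantor) :
    repeatMap f (repeatMap g x) = x := by
  funext i
  induction i generalizing x with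
  | zero => rfl
  | succ i ih =>
    rcases hx : x 0 with _ | _
    · rw [← cons_eta hx, repeatMap_cons_false, repeatMap_cons_false, h]
    · rw [← cons_eta hx, repeatMap_cons_true, repeatMap_cons_true, cons_succ, cons_succ, ih]

theorem IsFiniteState.repeatMap {f : Cantor → Cantor} (hf : IsFiniteState f) :
    IsFiniteState (repeatMap f) := by
  obtain ⟨c, C, hC, h⟩ := hf
  refine ⟨c, insert (RationalGroup.repeatMap f) C, hC.insert _, fun n => ?_⟩
  induction n with
  | zero =>
    exact fun p => ⟨0, _, Set.mem_insert _ _, by omega, by omega, fun x => by simp only [splice_zero]⟩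
  | succ n ih =>
    intro p
    rcases hp : p 0 with _ | _
    · obtain ⟨m, A, hA, h1, h2, h3⟩ := h n (tail 1 p)
      refine ⟨m + 1, A, .inr hA, by omega, by omega, fun x => ?_⟩
      rw [splice_succ, hp, repeatMap_cons_false, h3, cons_splice]
      conv_rhs => rw [← cons_eta hp, repeatMap_cons_false]
    · obtain ⟨m, A, hA, h1, h2, h3⟩ := ih (tail 1 p)
      refine ⟨m + 1, A, hA, by omega, by omega, fun x => ?_⟩
      rw [splice_succ, hp, repeatMap_cons_true, h3, cons_splice]
      conv_rhs => rw [← cons_eta hp, repeatMap_cons_true]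

/-- The element that acts as `f` on the digits after the first `0`. -/
def repeatElement (f : finiteStateGroup) : finiteStateGroup :=
  mk (repeatMap f.1) (repeatMap f⁻¹.1) f.2.1.repeatMap f.2.2.repeatMap
    (repeatMap_comp (inv_apply_self f)) (repeatMap_comp (apply_inv_self f))

theorem repeatElement_eq (f : finiteStateGroup) :
    repeatElement f =
      coneHom 1 (fun _ => false) f * coneHom 1 (fun _ => true) (repeatElement f) := by
  refine ext fun x => ?_
  rw [mul_apply]
  change repeatMap f.1 x = _
  rcases hx : x 0 with _ | _
  · rw [← cons_eta hx, repeatMap_cons_false, coneHom_of_not (p := fun _ => true),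
      ← splice_const_one, ← splice_const_one, coneHom_splice]
    exact fun h => absurd (h 0 one_pos) (by simp [cons_zero])
  · rw [← cons_eta hx, repeatMap_cons_true, ← splice_const_one, ← splice_const_one,
      coneHom_splice, coneHom_of_not]
    · rfl
    · exact fun h => absurd (h 0 one_pos) (by simp [splice])

/-- Every element supported in the cone of `10` is a commutator. -/
theorem exists_commutator_eq (f : finiteStateGroup) :
    ∃ a b : finiteStateGroup, a * b * a⁻¹ * b⁻¹ = coneHom 2 (cons true fun _ => false) f := by
  set t : Cantor := fun _ => true
  refine ⟨coneHom 1 t (repeatElement f), contraction⁻¹, ?_⟩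
  -- The repetition on the cone of `1` is `f` on the cone of `10` times the repetition on the cone
  -- of `11`; by `h2` the latter factor is a conjugate of the whole.
  have h1 : coneHom 1 t (repeatElement f) =
      coneHom 2 (cons true fun _ => false) f * coneHom 2 t (repeatElement f) := by
    conv_lhs => rw [repeatElement_eq, map_mul, coneHom_coneHom, coneHom_coneHom]
    rw [splice_one]
    congr 3
    ext i; simp [splice, t]
  have h2 : contraction⁻¹ * coneHom 1 t (repeatElement f) * contraction⁻¹⁻¹ =
      coneHom 2 t (repeatElement f) := by
    refine conj_coneHom (fun x => ?_) _
    rw [splice_one, splice_succ, splice_one]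
    change expandMap (cons true x) = cons true (cons true x)
    rw [expandMap, if_pos (cons_zero _ _)]
  rw [eq_mul_inv_of_mul_eq h1.symm, ← h2]
  group

theorem exists_cone_disjoint {f : finiteStateGroup} (hf : f ≠ 1) :
    ∃ n x, ∀ y, Agree n x y → ¬ Agree n x (f.1 y) := by
  obtain ⟨x, i, hi⟩ : ∃ x i, f.1 x i ≠ x i := by
    by_contra! h
    exact hf (ext fun x => funext (h x))
  obtain ⟨k, hk⟩ := f.2.1.exists_isLipschitz
  refine ⟨i + 1 + k, x, fun y hy h => hi ?_⟩
  rw [hk (i + 1) x y hy i (by omega), ← h i (by omega)]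

/-! ### Normal subgroups -/

section

variable {N : Subgroup finiteStateGroup} [N.Normal]

/-- With `c = f A⁻¹ f⁻¹` supported on the image of the cone, `c` commutes with `B`. Hence `[A, B] =
[A c, B]`, where `A c = [A, f]` lies in `N`. -/
theorem commutator_coneHom_mem {f : finiteStateGroup} (hf : f ∈ N) {n : ℕ} {p : Cantor}
    (h : ∀ y, Agree n p y → ¬ Agree n p (f.1 y)) (a b : finiteStateGroup) :
    coneHom n p (a * b * a⁻¹ * b⁻¹) ∈ N := by
  have hN : N.Normal := inferInstance
  simp only [map_mul, map_inv]
  set A := coneHom n p a with hA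
  set B := coneHom n p b with hB
  have hc : ∀ x, Agree n p x → (f * A⁻¹ * f⁻¹).1 x = x := by
    intro x hx
    have hx' : ¬ Agree n p (f⁻¹.1 x) := fun h' => h _ h' (by rwa [apply_inv_self])
    rw [mul_apply, mul_apply, hA, ← map_inv, coneHom_of_not _ hx', apply_inv_self]
  obtain ⟨c, hcdef⟩ : ∃ c, c = f * A⁻¹ * f⁻¹ := ⟨_, rfl⟩
  rw [← hcdef] at hc
  have hcB : c * B = B * c := by
    refine ext fun x => ?_
    rw [mul_apply, mul_apply]
    by_cases hx : Agree n p x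
    · rw [hc x hx, hc _ ((agree_coneHom_iff b).2 hx)]
    · have hx' : ¬ Agree n p (c.1 x) := fun h' => hx (by
        have := c.1.injective (hc _ h')
        rwa [this] at h')
      rw [hB, coneHom_of_not b hx, coneHom_of_not b hx']
  have hAc : A * c ∈ N := by
    have := N.mul_mem (hN.conj_mem f hf A) (N.inv_mem hf)
    rw [hcdef]
    convert this using 1
    group
  have h1 : A * B * A⁻¹ * B⁻¹ = A * c * (B * (A * c)⁻¹ * B⁻¹) := by
    calc A * B * A⁻¹ * B⁻¹ = A * (B * c) * c⁻¹ * A⁻¹ * B⁻¹ := by group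
      _ = A * (c * B) * c⁻¹ * A⁻¹ * B⁻¹ := by rw [hcB]
      _ = _ := by group
  rw [h1]
  exact N.mul_mem hAc (hN.conj_mem _ (N.inv_mem hAc) B)

theorem mem_of_fixes_cone (hN : N ≠ ⊥) {g : finiteStateGroup} {m : ℕ} {q : Cantor}
    (hg : ∀ x, Agree m q x → g.1 x = x) : g ∈ N := by
  obtain ⟨f, hf, hf1⟩ := N.bot_or_exists_ne_one.resolve_left hN
  obtain ⟨n, p, hp⟩ := exists_cone_disjoint hf1
  obtain ⟨h, hh⟩ := exists_move_into (n + 2) m q (splice n p (cons true fun _ => false))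
  obtain ⟨φ, hφ⟩ : ∃ φ, coneHom (n + 2) (splice n p (cons true fun _ => false)) φ = h * g * h⁻¹ := by
    refine exists_coneHom_eq fun x hx => ?_
    have hx' : Agree m q (h⁻¹.1 x) := by
      by_contra hc
      exact hx (by simpa using hh _ hc)
    rw [mul_apply, mul_apply, hg _ hx', apply_inv_self]
  obtain ⟨a, b, hab⟩ := exists_commutator_eq φ
  have h1 := commutator_coneHom_mem hf hp a b
  rw [hab, coneHom_coneHom, hφ] at h1
  simpa [mul_assoc] using ‹N.Normal›.conj_mem _ h1 h⁻¹

end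

/-- The map that acts as `f` on a cone, and as the inverse of `f` on the image of the cone. -/
noncomputable def exchangeMap (f : finiteStateGroup) (n : ℕ) (p : Cantor) : Cantor → Cantor :=
  open Classical in fun x =>
    if Agree n p x then f.1 x else if Agree n p (f⁻¹.1 x) then f⁻¹.1 x else x

theorem isFiniteState_exchangeMap (f : finiteStateGroup) (n : ℕ) (p : Cantor) :
    IsFiniteState (exchangeMap f n p) := by
  obtain ⟨k, hk⟩ := f.2.2.exists_isLipschitz
  refine .piecewise (n + k) fun q => ?_
  have h1 : ∀ x, Agree (n + k) q x → (Agree n p x ↔ Agree n p q) := fun x hx =>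
    ⟨fun h => h.trans (hx.mono (by omega)).symm, fun h => h.trans (hx.mono (by omega))⟩
  have h2 : ∀ x, Agree (n + k) q x → (Agree n p (f⁻¹.1 x) ↔ Agree n p (f⁻¹.1 q)) := fun x hx =>
    ⟨fun h => h.trans (hk n _ _ hx).symm, fun h => h.trans (hk n _ _ hx)⟩
  by_cases hq : Agree n p q
  · exact ⟨_, f.2.1, fun x hx => if_pos ((h1 x hx).2 hq)⟩
  by_cases hq' : Agree n p (f⁻¹.1 q)
  · exact ⟨_, f.2.2, fun x hx => by
      rw [exchangeMap, if_neg (mt (h1 x hx).1 hq), if_pos ((h2 x hx).2 hq')]; rfl⟩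
  · exact ⟨_, .id, fun x hx => by
      rw [exchangeMap, if_neg (mt (h1 x hx).1 hq), if_neg (mt (h2 x hx).1 hq')]⟩

theorem exchangeMap_exchangeMap {f : finiteStateGroup} {n : ℕ} {p : Cantor}
    (h : ∀ y, Agree n p y → ¬ Agree n p (f.1 y)) (x : Cantor) :
    exchangeMap f n p (exchangeMap f n p x) = x := by
  by_cases hx : Agree n p x
  · simp [exchangeMap, hx, h x hx]
  by_cases hx' : Agree n p (f⁻¹.1 x)
  · rw [exchangeMap.eq_def f n p x, if_neg hx, if_pos hx', exchangeMap, if_pos hx', apply_inv_self]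
  · have : exchangeMap f n p x = x := by rw [exchangeMap, if_neg hx, if_neg hx']
    rw [this, this]

/-- Every element is a product of two elements that each fix a cone. -/
theorem exists_eq_mul_fixes_cone (f : finiteStateGroup) :
    ∃ g h : finiteStateGroup, f = g * h ∧ (∃ n p, ∀ x, Agree n p x → g.1 x = x) ∧
      ∃ n p, ∀ x, Agree n p x → h.1 x = x := by
  by_cases hf : f = 1
  · exact ⟨1, 1, by rw [hf, mul_one], ⟨0, fun _ => false, fun _ _ => rfl⟩,
      ⟨0, fun _ => false, fun _ _ => rfl⟩⟩
  obtain ⟨n, p, hp⟩ := exists_cone_disjoint hf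
  -- One digit deeper than needed: the sibling cone inside the displaced cone then avoids both the
  -- small cone and its image, so `g` fixes it.
  have hp' : ∀ y, Agree (n + 1) p y → ¬ Agree (n + 1) p (f.1 y) := fun y hy h =>
    hp y (hy.mono (by omega)) (h.mono (by omega))
  let g := mk _ _ (isFiniteState_exchangeMap f (n + 1) p) (isFiniteState_exchangeMap f (n + 1) p)
    (exchangeMap_exchangeMap hp') (exchangeMap_exchangeMap hp')
  refine ⟨g, g⁻¹ * f, by group, ⟨n + 1, splice n p fun _ => !(p n), fun x hx => ?_⟩,
    ⟨n + 1, p, fun x hx => ?_⟩⟩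
  · have h1 : Agree n p x := (agree_splice n p _).trans (hx.mono (by omega))
    have h2 : ¬ Agree (n + 1) p x := fun h => by
      have := (h n (by omega)).trans (hx n (by omega)).symm
      simp [splice] at this
    have h3 : ¬ Agree (n + 1) p (f⁻¹.1 x) := fun h =>
      hp _ (h.mono (by omega)) (by rwa [apply_inv_self])
    change exchangeMap f (n + 1) p x = x
    rw [exchangeMap, if_neg h2, if_neg h3]
  · rw [mul_apply]
    have : f.1 x = g.1 x := (if_pos hx).symm
    rw [this, inv_apply_self]

instance : Nontrivial finiteStateGroup := by
  refine ⟨contraction, 1, fun h => ?_⟩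
  have := congrArg (fun f : finiteStateGroup => f.1 (cons true fun _ => false) 0) h
  exact absurd this (by simp [contraction, mk_apply, contractMap, cons])

theorem isSimpleGroup_finiteStateGroup : IsSimpleGroup finiteStateGroup where
  eq_bot_or_eq_top_of_normal N _ := by
    refine or_iff_not_imp_left.2 fun hN => (Subgroup.eq_top_iff' N).2 fun f => ?_
    obtain ⟨g, h, rfl, ⟨_, _, hg⟩, ⟨_, _, hh⟩⟩ := exists_eq_mul_fixes_cone f
    exact N.mul_mem (mem_of_fixes_cone hN hg) (mem_of_fixes_cone hN hh)

/-! ### Eventual periods and failure of finite generation -/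

/-- The sequence is eventually periodic with a period that divides a power of `D`. -/
def HasPeriodDvdPow (D : ℕ) (ψ : Cantor) : Prop :=
  ∃ e a, ∀ n ≥ a, ψ (n + D ^ e) = ψ n

theorem apply_add_mul_period {ψ : Cantor} {a d : ℕ} (h : ∀ n ≥ a, ψ (n + d) = ψ n) (j : ℕ) {n : ℕ}
    (hn : a ≤ n) : ψ (n + j * d) = ψ n := by
  induction j with
  | zero => simp
  | succ j ih => rw [add_mul, one_mul, ← add_assoc, h _ (by omega), ih]

/-- Pigeonhole: among `M + 1` positions spaced by the period `d`, two have the same local map and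
the same remaining input, so the output gains period `(j - i) * d`, and `j - i ≤ M` divides `M!`. -/
theorem IsFiniteState.exists_hasPeriodDvdPow {f : Cantor → Cantor} (hf : IsFiniteState f) :
    ∃ N : ℕ, ∀ M ≥ N, ∀ ψ, HasPeriodDvdPow M.factorial ψ → HasPeriodDvdPow M.factorial (f ψ) := by
  obtain ⟨c, -, hfin⟩ := hf.exists_finite_localMap
  refine ⟨hfin.toFinset.card, fun M hM ψ => ?_⟩
  rintro ⟨e, a, ha⟩
  set d := M.factorial ^ e with hd
  let u : ℕ → ℕ := fun i => a + c + i * d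
  obtain ⟨i, hi, j, hj, hne, hij⟩ := Finset.exists_ne_map_eq_of_card_lt_of_maps_to
    (s := Finset.range (M + 1)) (t := hfin.toFinset) (by rw [Finset.card_range]; omega)
    (f := fun i => localMap f c (u i) ψ) (fun i _ => by simp)
  wlog hlt : i < j generalizing i j
  · exact this j hj i hi hne.symm hij.symm (by omega)
  have htail : ∀ i, tail (u i) ψ = tail (a + c) ψ := fun i => by
    funext l
    simp only [tail, u]
    rw [← apply_add_mul_period ha i (n := a + c + l) (by omega)]
    congr 1; omega
  have hloc : ∀ i, localMap f c (u i) ψ (tail (a + c) ψ) = tail (a + i * d) (f ψ) := fun i => by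
    rw [← htail i, localMap, RationalGroup.splice_tail]
    congr 1; simp only [u]; omega
  have hper : ∀ n ≥ a + i * d, f ψ (n + (j - i) * d) = f ψ n := by
    intro n hn
    have h1 := congrFun ((hloc i).symm.trans ((congrFun hij _).trans (hloc j))) (n - (a + i * d))
    simp only [tail] at h1
    have h2 : j * d = i * d + (j - i) * d := by rw [← add_mul]; congr 1; omega
    rw [h2] at h1
    convert h1.symm using 2 <;> omega
  refine ⟨e + 1, a + i * d, fun n hn => ?_⟩
  have hdvd : (j - i) ∣ M.factorial := Nat.dvd_factorial (by omega) (by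
    have := Finset.mem_range.1 hj; omega)
  obtain ⟨r, hr⟩ := hdvd
  have : M.factorial ^ (e + 1) = r * ((j - i) * d) := by
    rw [pow_succ, ← hd]
    nth_rewrite 1 [hr]
    ring
  rw [this]
  exact apply_add_mul_period hper r hn

/-- The indicator sequence of the multiples of `q`. -/
def multiples (q : ℕ) : Cantor := fun n => decide (q ∣ n)

theorem finite_tails_multiples {q : ℕ} (hq : 0 < q) :
    (Set.range fun n => tail n (multiples q)).Finite :=
  finite_tails_of_eq (a := 0) hq fun n _ => by simp [multiples]

theorem not_hasPeriodDvdPow_multiples {M q : ℕ} (hq : q.Prime) (hMq : M < q) :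
    ¬ HasPeriodDvdPow M.factorial (multiples q) := by
  rintro ⟨e, a, h⟩
  have h1 := h (q * a) (Nat.le_mul_of_pos_left a hq.pos)
  have h2 : q ∣ M.factorial ^ e := by
    simpa [multiples, (Nat.dvd_add_right (Nat.dvd_mul_right q a))] using h1
  exact absurd ((hq.dvd_factorial).1 (hq.dvd_of_dvd_pow h2)) (by omega)

theorem not_fg_finiteStateGroup : ¬ Group.FG finiteStateGroup := by
  intro hFG
  obtain ⟨S, hS⟩ := hFG.out
  choose b hb using fun f : finiteStateGroup => f.2.1.exists_hasPeriodDvdPow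
  -- Inverses of generators are included so that membership in the class is preserved in both
  -- directions.
  let M := S.sup fun f => max (b f) (b f⁻¹)
  have hM : ∀ f ∈ S, max (b f) (b f⁻¹) ≤ M := fun f hf =>
    Finset.le_sup (f := fun f => max (b f) (b f⁻¹)) hf
  have key : ∀ f : finiteStateGroup, ∀ ψ,
      HasPeriodDvdPow M.factorial ψ ↔ HasPeriodDvdPow M.factorial (f.1 ψ) := by
    intro f
    have hf : f ∈ Subgroup.closure (S : Set finiteStateGroup) := hS ▸ Subgroup.mem_top f
    induction hf using Subgroup.closure_induction with
    | mem f hf =>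
      have := hM f hf
      refine fun ψ => ⟨hb f M (by omega) ψ, fun h => ?_⟩
      simpa using hb f⁻¹ M (by omega) _ h
    | one => exact fun ψ => Iff.rfl
    | mul f g _ _ hf hg => exact fun ψ => (hg ψ).trans (hf _)
    | inv f _ hf => exact fun ψ => by rw [hf (f⁻¹.1 ψ), apply_inv_self]
  obtain ⟨q, hMq, hq⟩ := Nat.exists_infinite_primes (M + 1)
  refine not_hasPeriodDvdPow_multiples hq hMq ?_
  have h1 := (key (xorElement (multiples q) (finite_tails_multiples hq.pos)) fun _ => false).1
    ⟨0, 0, fun _ _ => rfl⟩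
  have h2 : (xorElement (multiples q) (finite_tails_multiples hq.pos)).1 (fun _ => false) =
      multiples q := by
    funext i
    exact Bool.xor_false _
  rwa [h2] at h1

end RationalGroup

/-- The rational bilipschitz homeomorphisms of the Cantor set form a group under composition,
and this group is simple but not finitely generated. -/
theorem theorem2 :
    ∃ G : Subgroup (RationalGroup.Cantor ≃ₜ RationalGroup.Cantor),
      (∀ f : RationalGroup.Cantor ≃ₜ RationalGroup.Cantor,
        f ∈ G ↔ RationalGroup.IsRational f ∧ RationalGroup.IsBilipschitz f) ∧
      IsSimpleGroup G ∧ ¬ Group.FG G := by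
  exact ⟨RationalGroup.finiteStateGroup, RationalGroup.mem_finiteStateGroup_iff,
    RationalGroup.isSimpleGroup_finiteStateGroup, RationalGroup.not_fg_finiteStateGroup⟩
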